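/- Let $n\ge 1$ be an integer. For $\theta\in[0,1]$ let ${\rm TH}_\theta:\{0,1\}^n\to\{0,1\}$ be the threshold function with ${\rm TH}_\theta(x)=1$ if and only if $\frac1n\sum_{i=1}^n x_i\ge\theta$. For a commutative ring $R$ and a Boolean function $f:\{0,1\}^n\to\{0,1\}$, a probabilistic polynomial over $R$ for $f$ with degree $d$ and error $\varepsilon$ is a probability distribution $\mathcal D$ on polynomials in $R[x_1,\dots,x_n]$ of total degree at most $d$ such that for every $x\in\{0,1\}^n$, $\Pr_{p\sim\mathcal D}[p(x)=f(x)]\ge 1-\varepsilon$. A distribution can be sampled with $r$ random bits if it is the distribution of $G(\omega)$ for some function $G$ on $\{0,1\}^r$, where $\omega$ is uniformly random in $\{0,1\}^r$. Theorem. There is an absolute constant $C>0$ such that for every $\theta\in[0,1]$, every integer $n\ge1$ and every real $s\ge2$ there is a distribution $\mathcal D$ on polynomials in $\mathbb Z[x_1,\dots,x_n]$ which can be sampled with at most $C\log n\cdot\log(ns)$ random bits and which, over $\mathbb Z$ and (after reducing the coefficients) over every commutative ring $R$, is a probabilistic polynomial for ${\rm TH}_\theta$ on $n$ bits with degree $C\sqrt{n\log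 s}$ and error $1/s$. -/

import Mathlib

/-- The number `|x|` of ones in a Boolean vector. -/
def hammingWeight {n : ℕ} (x : Fin n → Bool) : ℕ :=
  (Finset.univ.filter fun i => x i = true).card

open Classical in
/-- The threshold function `TH_θ` on `n` bits: is the fraction `|x| / n` of ones at least `θ`? -/
noncomputable def thresholdFn (n : ℕ) (θ : ℝ) (x : Fin n → Bool) : Bool :=
  decide (θ ≤ (hammingWeight x : ℝ) / (n : ℝ))

/-- A bit as an element `0` or `1` of a ring. -/
def bitVal (R : Type*) [CommRing R] (b : Bool) : R := if b then 1 else 0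

/-- The distribution `D` is a probabilistic polynomial over `R` for the Boolean function `f`
on `n` bits, with degree (at most) `d` and error `ε`. -/
structure IsProbabilisticPolynomial (R : Type*) [CommRing R] {n : ℕ}
    (f : (Fin n → Bool) → Bool) (d ε : ℝ) (D : PMF (MvPolynomial (Fin n) R)) : Prop where
  degree_le : ∀ p ∈ D.support, (p.totalDegree : ℝ) ≤ d
  correct : ∀ x : Fin n → Bool,
    1 - ε ≤ (D.toOuterMeasure
      {p | MvPolynomial.eval (fun i => bitVal R (x i)) p = bitVal R (f x)}).toReal

/-- The distribution `D` can be sampled using `r` random bits: it is the law of `G ω` for some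
function `G` of a uniformly random string `ω` of `r` bits. -/
def SampledWithBits {α : Type*} (D : PMF α) (r : ℕ) : Prop :=
  ∃ G : (Fin r → Bool) → α, D = (PMF.uniformOfFintype (Fin r → Bool)).map G

/-! A deterministic symmetric polynomial of degree about `b * n` computes the threshold for vectors
whose fraction of ones is within `b` of `θ`, because any integer function of the weight can be
interpolated over ℤ on a short window (`exists_polynomial_eq_on_window`). Far from `θ`, a random
sample of `N / 64` coordinates already gives the answer. Recursive polynomials on the sample, at `θ
- a` and `θ + a`, detect which case holds, and `eval_combine` switches between the sample's answer
and the interpolant. With `a` of order `√(L / N)`, the interpolant costs degree `O(√(N * L))`. The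
three recursive degrees add up to a fixed fraction of the target bound, so the recursion closes at
`O(√(N * L))` with error `exp (-L)` (`exists_random_threshold_polynomial`). This uses too much
randomness. By Hoeffding and a union bound over the `2 ^ n` inputs, some fixed list of `O(n * s ^
2)` seeds at most doubles the error (`exists_seeds_ncard_le`), and indexing it takes `O(log (n *
s))` bits. -/

/-! ### Hoeffding's inequality by counting. -/

open Finset in
/-- Hoeffding's upper tail bound for `m` independent uniform samples from a finite type, in
counting form. -/
theorem card_sum_ge_le_exp {Ω : Type*} [Fintype Ω] (f : Ω → ℝ) (h0 : ∀ ω, 0 ≤ f ω)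
    (h1 : ∀ ω, f ω ≤ 1) {μ a : ℝ} (hμ0 : 0 ≤ μ) (hμ1 : μ ≤ 1)
    (hmean : ∑ ω, f ω ≤ μ * Fintype.card Ω) (ha : 0 ≤ a) (m : ℕ) :
    ({h : Fin m → Ω | m * (μ + a) ≤ ∑ i, f (h i)}.ncard : ℝ)
      ≤ Real.exp (-(m * a ^ 2 / 2)) * (Fintype.card Ω : ℝ) ^ m := by
  classical
  have key : ∑ ω, Real.exp (a * (f ω - μ - a)) ≤ Real.exp (-(a ^ 2 / 2)) * Fintype.card Ω := by
    have hpt : ∀ ω, Real.exp (a * (f ω - μ - a))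
        ≤ Real.exp (-a ^ 2) * (Real.cosh a + (f ω - μ) * Real.sinh a) := by
      intro ω
      -- On `[-1, 1]` the exponential `t ↦ exp (a * t)` lies below its chord `cosh a + t * sinh a`.
      -- The centred mean is at most 0, so only `cosh a` survives the sum.
      have hc := convexOn_exp.2 (Set.mem_univ (-a)) (Set.mem_univ a)
        (show 0 ≤ (1 - (f ω - μ)) / 2 by linarith [h0 ω, h1 ω])
        (show 0 ≤ (1 + (f ω - μ)) / 2 by linarith [h0 ω, h1 ω]) (by ring)
      rw [show a * (f ω - μ - a) = -a ^ 2 + a * (f ω - μ) by ring, Real.exp_add]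
      refine mul_le_mul_of_nonneg_left ?_ (Real.exp_pos _).le
      rw [Real.cosh_eq, Real.sinh_eq]
      simp only [smul_eq_mul] at hc
      rw [show (1 - (f ω - μ)) / 2 * -a + (1 + (f ω - μ)) / 2 * a = a * (f ω - μ) by ring] at hc
      linarith
    calc _ ≤ ∑ ω, Real.exp (-a ^ 2) * (Real.cosh a + (f ω - μ) * Real.sinh a) :=
          sum_le_sum fun ω _ => hpt ω
      _ = Real.exp (-a ^ 2) * (Fintype.card Ω * Real.cosh a
            + (∑ ω, f ω - μ * Fintype.card Ω) * Real.sinh a) := by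
          rw [← mul_sum, sum_add_distrib, ← sum_mul, sum_sub_distrib]
          simp [mul_comm]
      _ ≤ Real.exp (-a ^ 2) * (Fintype.card Ω * Real.exp (a ^ 2 / 2)) := by
          gcongr
          have hs : 0 ≤ Real.sinh a := Real.sinh_nonneg_iff.2 ha
          have hc : (Fintype.card Ω : ℝ) * Real.cosh a ≤ Fintype.card Ω * Real.exp (a ^ 2 / 2) :=
            mul_le_mul_of_nonneg_left (Real.cosh_le_exp_half_sq a) (Nat.cast_nonneg _)
          nlinarith
      _ = _ := by
          rw [mul_left_comm, ← Real.exp_add, mul_comm]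
          ring_nf
  rw [Set.ncard_eq_toFinset_card', Set.toFinset_ofPred]
  calc ((univ.filter fun h : Fin m → Ω => m * (μ + a) ≤ ∑ i, f (h i)).card : ℝ)
      = ∑ h ∈ univ.filter fun h : Fin m → Ω => m * (μ + a) ≤ ∑ i, f (h i), (1 : ℝ) := by simp
    _ ≤ ∑ h ∈ univ.filter fun h : Fin m → Ω => m * (μ + a) ≤ ∑ i, f (h i),
          ∏ i, Real.exp (a * (f (h i) - μ - a)) := by
        refine sum_le_sum fun h hh => ?_
        rw [← Real.exp_sum, ← mul_sum]
        apply Real.one_le_exp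
        have := (mem_filter.1 hh).2
        simp only [sum_sub_distrib, sum_const, card_univ, Fintype.card_fin, nsmul_eq_mul]
        exact mul_nonneg ha (by linarith)
    _ ≤ ∑ h : Fin m → Ω, ∏ i, Real.exp (a * (f (h i) - μ - a)) :=
        sum_le_sum_of_subset_of_nonneg (filter_subset _ _) fun _ _ _ =>
          prod_nonneg fun _ _ => (Real.exp_pos _).le
    _ = (∑ ω, Real.exp (a * (f ω - μ - a))) ^ m := (Fintype.sum_pow (fun ω => Real.exp (a * (f ω - μ - a))) m).symm
    _ ≤ (Real.exp (-(a ^ 2 / 2)) * Fintype.card Ω) ^ m :=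
        pow_le_pow_left₀ (sum_nonneg fun _ _ => (Real.exp_pos _).le) key m
    _ = _ := by
        rw [mul_pow, ← Real.exp_nat_mul]
        ring_nf

/-! ### Integer interpolation in the Hamming weight. -/

/-- A Boolean vector as an integer point. -/
def boolPoint {n : ℕ} (x : Fin n → Bool) (i : Fin n) : ℤ := bitVal ℤ (x i)

open Finset MvPolynomial in
theorem eval_esymm_boolPoint {n : ℕ} (x : Fin n → Bool) (j : ℕ) :
    eval (boolPoint x) (esymm (Fin n) ℤ j) = (hammingWeight x).choose j := by
  classical
  simp only [esymm, map_sum, map_prod, eval_X, boolPoint, bitVal, hammingWeight]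
  simp_rw [prod_ite_zero, prod_const_one]
  rw [← card_powersetCard, sum_boole]
  congr 2
  ext t
  simp [mem_powersetCard, subset_iff, and_comm]

open Finset MvPolynomial in
theorem totalDegree_esymm_le (n j : ℕ) : (esymm (Fin n) ℤ j).totalDegree ≤ j := by
  refine totalDegree_finsetSum_le fun t ht => ?_
  refine (totalDegree_finsetProd _ _).trans ?_
  simp [(mem_powersetCard.1 ht).2]

open Finset MvPolynomial in
/-- The polynomial `C(|x| - w, d)`. -/
theorem exists_polynomial_choose_sub (n w d : ℕ) :
    ∃ A : MvPolynomial (Fin n) ℤ, A.totalDegree ≤ d ∧ ∀ x : Fin n → Bool,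
      eval (boolPoint x) A = Ring.choose ((hammingWeight x : ℤ) - w) d := by
  refine ⟨∑ ij ∈ antidiagonal d, C (Ring.choose (-(w : ℤ)) ij.2) * esymm (Fin n) ℤ ij.1, ?_, ?_⟩
  · refine totalDegree_finsetSum_le fun ij h => (totalDegree_mul _ _).trans ?_
    have := totalDegree_esymm_le n ij.1
    have := mem_antidiagonal.1 h
    simp only [totalDegree_C]
    omega
  · intro x
    -- Chu–Vandermonde with `C(|x|, i)` as the value of the `i`-th elementary symmetric polynomial;
    -- the other factors are integers, so no denominators appear.
    rw [sub_eq_add_neg, Ring.add_choose_eq _ (Commute.all _ _)]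
    simp [eval_esymm_boolPoint, mul_comm, Ring.choose_natCast]

open MvPolynomial in
/-- Any function of the Hamming weight agrees with an integer polynomial of degree `d` on a window
of `d + 1` consecutive weights. -/
theorem exists_polynomial_eq_on_window (n w d : ℕ) (g : ℕ → ℤ) :
    ∃ A : MvPolynomial (Fin n) ℤ, A.totalDegree ≤ d ∧ ∀ x : Fin n → Bool,
      w ≤ hammingWeight x → hammingWeight x ≤ w + d → eval (boolPoint x) A = g (hammingWeight x) := by
  -- Newton interpolation needs the value of `A` outside the window to depend on the weight alone,
  -- so that one integer multiple of `C(|x| - w, d + 1)`, which vanishes on the old window, corrects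
  -- the next weight.
  suffices h : ∃ A : MvPolynomial (Fin n) ℤ, A.totalDegree ≤ d ∧ ∃ G : ℕ → ℤ,
      (∀ x : Fin n → Bool, w ≤ hammingWeight x → eval (boolPoint x) A = G (hammingWeight x)) ∧
      ∀ k, w ≤ k → k ≤ w + d → G k = g k by
    obtain ⟨A, hA, G, hG, hg⟩ := h
    exact ⟨A, hA, fun x h1 h2 => (hG x h1).trans (hg _ h1 h2)⟩
  induction d with
  | zero =>
    refine ⟨C (g w), (totalDegree_C _).le, fun _ => g w, by simp, fun k h1 h2 => ?_⟩
    rw [le_antisymm h2 h1, add_zero]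
  | succ d ih =>
    obtain ⟨A, hA, G, hG, hg⟩ := ih
    obtain ⟨B, hB, hB'⟩ := exists_polynomial_choose_sub n w (d + 1)
    refine ⟨A + C (g (w + (d + 1)) - G (w + (d + 1))) * B, ?_,
      fun k => G k + (g (w + (d + 1)) - G (w + (d + 1))) * ((k - w).choose (d + 1) : ℕ), ?_, ?_⟩
    · refine (totalDegree_add _ _).trans (max_le (by omega) ((totalDegree_mul _ _).trans ?_))
      rwa [totalDegree_C, zero_add]
    · intro x hx
      rw [map_add, map_mul, eval_C, hG x hx, hB', ← Nat.cast_sub hx, Ring.choose_natCast]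
    · intro k h1 h2
      dsimp only
      rcases h2.lt_or_eq with h | rfl
      · rw [Nat.choose_eq_zero_of_lt (by omega), hg k h1 (by omega)]
        simp
      · simp

/-! ### Random samples of coordinates. -/

open Finset in
theorem hammingWeight_eq_sum {n : ℕ} (x : Fin n → Bool) :
    (hammingWeight x : ℝ) = ∑ i, if x i = true then 1 else 0 := by
  simp [hammingWeight]

theorem hammingWeight_le {n : ℕ} (x : Fin n → Bool) : hammingWeight x ≤ n :=
  (Finset.card_filter_le _ _).trans (by simp)

open Classical in
theorem bitVal_thresholdFn (R : Type*) [CommRing R] (n : ℕ) (θ : ℝ) (x : Fin n → Bool) :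
    bitVal R (thresholdFn n θ x) = if θ ≤ (hammingWeight x : ℝ) / n then 1 else 0 := by
  simp [bitVal, thresholdFn]

/-- A random sample of `n` coordinates has nearly the same fraction of ones as the whole vector. -/
theorem ncard_sample_deviation_le {N : ℕ} (hN : 0 < N) (x : Fin N → Bool) {n : ℕ} (hn : 0 < n)
    {a : ℝ} (ha : 0 ≤ a) :
    ({h : Fin n → Fin N | a < |(hammingWeight (x ∘ h) : ℝ) / n - (hammingWeight x : ℝ) / N|}.ncard
      : ℝ) ≤ 2 * Real.exp (-(n * a ^ 2 / 2)) * Fintype.card (Fin n → Fin N) := by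
  have hN' : (0 : ℝ) < N := by exact_mod_cast hN
  have hn' : (0 : ℝ) < n := by exact_mod_cast hn
  set μ : ℝ := (hammingWeight x : ℝ) / N with hμ
  have hμ0 : 0 ≤ μ := by positivity
  have hμ1 : μ ≤ 1 := (div_le_one hN').2 (by exact_mod_cast hammingWeight_le x)
  set f : Fin N → ℝ := fun i => if x i = true then 1 else 0 with hf
  have hf0 : ∀ i, 0 ≤ f i := fun i => by simp only [hf]; split_ifs <;> norm_num
  have hf1 : ∀ i, f i ≤ 1 := fun i => by simp only [hf]; split_ifs <;> norm_num
  have hsum : ∑ i, f i = μ * N := by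
    rw [hμ, div_mul_cancel₀ _ hN'.ne', hammingWeight_eq_sum]
  have hup := card_sum_ge_le_exp f hf0 hf1 hμ0 hμ1 (by simp [hsum]) ha n
  have hlo := card_sum_ge_le_exp (fun i => 1 - f i) (fun i => by linarith [hf1 i])
    (fun i => by linarith [hf0 i]) (μ := 1 - μ) (by linarith) (by linarith)
    (by simp [hsum]; linarith) ha n
  have hsub : {h : Fin n → Fin N | a < |(hammingWeight (x ∘ h) : ℝ) / n - μ|} ⊆
      {h : Fin n → Fin N | n * (μ + a) ≤ ∑ i, f (h i)} ∪
      {h : Fin n → Fin N | n * (1 - μ + a) ≤ ∑ i, (1 - f (h i))} := by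
    intro h hh
    have hw : (hammingWeight (x ∘ h) : ℝ) = ∑ i, f (h i) := hammingWeight_eq_sum _
    have hh' : a < |(hammingWeight (x ∘ h) : ℝ) / n - μ| := hh
    rw [hw] at hh'
    rcases lt_abs.1 hh' with h1 | h1
    · left
      have : μ + a < (∑ i, f (h i)) / n := by linarith
      rw [lt_div_iff₀ hn'] at this
      simp only [Set.mem_ofPred_eq]
      linarith
    · right
      have : (∑ i, f (h i)) / n < μ - a := by linarith
      rw [div_lt_iff₀ hn'] at this
      simp only [Set.mem_ofPred_eq, Finset.sum_sub_distrib, Finset.sum_const, Finset.card_univ,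
        Fintype.card_fin, nsmul_eq_mul]
      linarith
  have hc : ({h : Fin n → Fin N | a < |(hammingWeight (x ∘ h) : ℝ) / n - μ|}.ncard : ℝ) ≤
      {h : Fin n → Fin N | n * (μ + a) ≤ ∑ i, f (h i)}.ncard +
      {h : Fin n → Fin N | n * (1 - μ + a) ≤ ∑ i, (1 - f (h i))}.ncard := by
    exact_mod_cast (Set.ncard_le_ncard hsub (Set.toFinite _)).trans (Set.ncard_union_le _ _)
  have hcard : (Fintype.card (Fin n → Fin N) : ℝ) = (N : ℝ) ^ n := by simp
  rw [hcard]
  simp only [Fintype.card_fin] at hup hlo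
  linarith

open Finset in
/-- A union bound over a product of two finite probability spaces. -/
theorem ncard_prod_or_le {Ω H : Type*} [Fintype Ω] [Fintype H] (B₁ : Ω → H → Prop) (B₂ : H → Prop)
    {ε₁ ε₂ : ℝ} (h₁ : ∀ h, ({ω | B₁ ω h}.ncard : ℝ) ≤ ε₁ * Fintype.card Ω)
    (h₂ : ({h | B₂ h}.ncard : ℝ) ≤ ε₂ * Fintype.card H) :
    ({p : Ω × H | B₁ p.1 p.2 ∨ B₂ p.2}.ncard : ℝ) ≤ (ε₁ + ε₂) * Fintype.card (Ω × H) := by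
  classical
  simp only [Set.ncard_eq_toFinset_card', Set.toFinset_ofPred] at *
  have e₁ : ((univ.filter fun p : Ω × H => B₁ p.1 p.2).card : ℝ)
      ≤ ε₁ * Fintype.card Ω * Fintype.card H := by
    rw [card_filter, Fintype.sum_prod_type_right]
    push_cast
    calc _ ≤ ∑ _h : H, ε₁ * Fintype.card Ω := sum_le_sum fun h _ => by simpa using h₁ h
      _ = _ := by simp [mul_comm]
  have e₂ : ((univ.filter fun p : Ω × H => B₂ p.2).card : ℝ)
      ≤ ε₂ * Fintype.card H * Fintype.card Ω := by
    rw [card_filter, Fintype.sum_prod_type]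
    push_cast
    calc _ ≤ ∑ _ω : Ω, ε₂ * Fintype.card H := sum_le_sum fun h _ => by simpa using h₂
      _ = _ := by simp [mul_comm]
  have e : ((univ.filter fun p : Ω × H => B₁ p.1 p.2 ∨ B₂ p.2).card : ℝ) ≤
      (univ.filter fun p : Ω × H => B₁ p.1 p.2).card + (univ.filter fun p : Ω × H => B₂ p.2).card := by
    rw [filter_or]
    exact_mod_cast card_union_le _ _
  rw [Fintype.card_prod]
  push_cast
  linarith

/-! ### Threshold polynomials by interpolation. -/

open MvPolynomial in
/-- Some polynomial of degree `n` equals `TH_θ` everywhere. -/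
theorem exists_polynomial_eq_threshold (n : ℕ) (θ : ℝ) :
    ∃ A : MvPolynomial (Fin n) ℤ, A.totalDegree ≤ n ∧ ∀ x : Fin n → Bool,
      eval (boolPoint x) A = bitVal ℤ (thresholdFn n θ x) := by
  classical
  obtain ⟨A, hA, h⟩ := exists_polynomial_eq_on_window n 0 n
    fun w => if θ ≤ (w : ℝ) / n then 1 else 0
  refine ⟨A, hA, fun x => ?_⟩
  rw [h x (Nat.zero_le _) (by simpa using hammingWeight_le x), bitVal_thresholdFn]

open MvPolynomial in
/-- Some polynomial of degree `2bn` equals `TH_θ` on the vectors whose fraction of ones is within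
`b` of `θ`. -/
theorem exists_polynomial_eq_threshold_near {n : ℕ} (hn : 0 < n) (θ : ℝ) {b : ℝ} (hb : 0 ≤ b) :
    ∃ A : MvPolynomial (Fin n) ℤ, (A.totalDegree : ℝ) ≤ 2 * b * n ∧ ∀ x : Fin n → Bool,
      |(hammingWeight x : ℝ) / n - θ| ≤ b →
        eval (boolPoint x) A = bitVal ℤ (thresholdFn n θ x) := by
  classical
  have hn' : (0 : ℝ) < n := by exact_mod_cast hn
  have hbn : 0 ≤ b * n := by positivity
  obtain ⟨A, hA, h⟩ := exists_polynomial_eq_on_window n ⌈(θ - b) * n⌉₊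
    (⌊(θ + b) * n⌋₊ - ⌈(θ - b) * n⌉₊) fun w => if θ ≤ (w : ℝ) / n then 1 else 0
  refine ⟨A, ?_, fun x hx => ?_⟩
  · refine (Nat.cast_le.2 hA).trans ?_
    rcases le_total ⌊(θ + b) * n⌋₊ ⌈(θ - b) * n⌉₊ with hle | hle
    · rw [Nat.sub_eq_zero_of_le hle]
      push_cast
      linarith
    · rw [Nat.cast_sub hle]
      have h1 := Nat.le_ceil ((θ - b) * n)
      rcases le_total 0 ((θ + b) * n) with h0 | h0
      · have h2 := Nat.floor_le h0
        linarith
      · rw [Nat.floor_of_nonpos h0]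
        have : (0 : ℝ) ≤ ⌈(θ - b) * n⌉₊ := Nat.cast_nonneg _
        push_cast
        linarith
  · rw [abs_le] at hx
    have h1 : ⌈(θ - b) * n⌉₊ ≤ hammingWeight x := by
      refine Nat.ceil_le.2 ((le_div_iff₀ hn').1 ?_)
      linarith
    have h2 : hammingWeight x ≤ ⌊(θ + b) * n⌋₊ := by
      refine Nat.le_floor ((div_le_iff₀ hn').1 ?_)
      linarith
    rw [h x h1 (by omega), bitVal_thresholdFn]

/-! ### Recursion on the number of variables. -/

open MvPolynomial in
theorem eval_rename_boolPoint {n N : ℕ} (h : Fin n → Fin N) (q : MvPolynomial (Fin n) ℤ)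
    (x : Fin N → Bool) :
    eval (boolPoint x) (rename h q) = eval (boolPoint (x ∘ h)) q := by
  rw [eval_rename]
  rfl

open MvPolynomial in
/-- Given a vector `x` and a sample `h` of its coordinates, combine threshold polynomials `q₀`, `q₁`,
`q₂` for the sample at `θ`, `θ - a`, `θ + a` with a polynomial `A` that is right near `θ`. -/
theorem eval_combine {n N : ℕ} (h : Fin n → Fin N) (x : Fin N → Bool) {θ a : ℝ}
    {A : MvPolynomial (Fin N) ℤ} {q₀ q₁ q₂ : MvPolynomial (Fin n) ℤ}
    (hdev : |(hammingWeight (x ∘ h) : ℝ) / n - (hammingWeight x : ℝ) / N| ≤ a)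
    (hA : |(hammingWeight x : ℝ) / N - θ| ≤ 2 * a →
      eval (boolPoint x) A = bitVal ℤ (thresholdFn N θ x))
    (h₀ : eval (boolPoint (x ∘ h)) q₀ = bitVal ℤ (thresholdFn n θ (x ∘ h)))
    (h₁ : eval (boolPoint (x ∘ h)) q₁ = bitVal ℤ (thresholdFn n (θ - a) (x ∘ h)))
    (h₂ : eval (boolPoint (x ∘ h)) q₂ = bitVal ℤ (thresholdFn n (θ + a) (x ∘ h))) :
    eval (boolPoint x) (rename h q₀ + rename h q₁ * (1 - rename h q₂) * (A - rename h q₀))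
      = bitVal ℤ (thresholdFn N θ x) := by
  classical
  simp only [map_add, map_mul, map_sub, map_one, eval_rename_boolPoint, h₀, h₁, h₂]
  rw [abs_le] at hdev
  simp only [abs_le, bitVal_thresholdFn] at *
  generalize (hammingWeight (x ∘ h) : ℝ) / n = u at *
  generalize (hammingWeight x : ℝ) / N = v at *
  -- If `θ - a ≤ u < θ + a`, the switch is 1, the value is that of `A`, and `v` is within `2 * a` of
  -- `θ`. Otherwise the switch is 0, and `u` and `v` lie on the same side of `θ`.
  by_cases c1 : θ - a ≤ u
  · by_cases c2 : θ + a ≤ u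
    · simp [c1, c2, show θ ≤ u by linarith, show θ ≤ v by linarith]
    · rw [hA ⟨by linarith, by linarith⟩]
      simp [c1, c2]
  · simp [c1, show ¬ θ ≤ u by intro; linarith, show ¬ θ ≤ v by intro; linarith]

open MvPolynomial in
theorem totalDegree_combine_le {n N : ℕ} (h : Fin n → Fin N) {A : MvPolynomial (Fin N) ℤ}
    {q₀ q₁ q₂ : MvPolynomial (Fin n) ℤ} {α δ : ℝ} (hα : (A.totalDegree : ℝ) ≤ α)
    (h₀ : (q₀.totalDegree : ℝ) ≤ δ) (h₁ : (q₁.totalDegree : ℝ) ≤ δ)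
    (h₂ : (q₂.totalDegree : ℝ) ≤ δ) :
    ((rename h q₀ + rename h q₁ * (1 - rename h q₂) * (A - rename h q₀)).totalDegree : ℝ)
      ≤ α + 3 * δ := by
  have r₀ := totalDegree_rename_le h q₀
  have r₁ := totalDegree_rename_le h q₁
  have r₂ := totalDegree_rename_le h q₂
  have t₁ := totalDegree_add (rename h q₀) (rename h q₁ * (1 - rename h q₂) * (A - rename h q₀))
  have t₂ := totalDegree_mul (rename h q₁ * (1 - rename h q₂)) (A - rename h q₀)
  have t₃ := totalDegree_mul (rename h q₁) (1 - rename h q₂)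
  have t₄ := totalDegree_sub A (rename h q₀)
  have t₅ := totalDegree_sub 1 (rename h q₂)
  rw [totalDegree_one] at t₅
  have : (rename h q₀ + rename h q₁ * (1 - rename h q₂) * (A - rename h q₀)).totalDegree
      ≤ A.totalDegree + q₀.totalDegree + q₁.totalDegree + q₂.totalDegree := by omega
  have : ((rename h q₀ + rename h q₁ * (1 - rename h q₂) * (A - rename h q₀)).totalDegree : ℝ)
      ≤ A.totalDegree + q₀.totalDegree + q₁.totalDegree + q₂.totalDegree := by exact_mod_cast this
  linarith

open MvPolynomial in
/-- A finite uniform probability space of polynomials of degree `O(√(N (L + 2)))` such that each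
vector is, up to probability `e ^ (-L)`, handled correctly for all thresholds at once. -/
theorem exists_random_threshold_polynomial (N : ℕ) : ∀ L : ℝ, 0 ≤ L →
    ∃ (Ω : Type) (_ : Fintype Ω) (_ : Nonempty Ω) (p : ℝ → Ω → MvPolynomial (Fin N) ℤ),
      (∀ θ ω, ((p θ ω).totalDegree : ℝ) ≤ 200 * Real.sqrt (N * (L + 2))) ∧
      ∀ x : Fin N → Bool,
        ({ω | ∃ θ, eval (boolPoint x) (p θ ω) ≠ bitVal ℤ (thresholdFn N θ x)}.ncard : ℝ)
          ≤ Real.exp (-L) * Fintype.card Ω := by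
  induction N using Nat.strong_induction_on with
  | _ N ih =>
  intro L hL
  have hu : 0 ≤ Real.sqrt (N * (L + 2)) := Real.sqrt_nonneg _
  have hu2 : Real.sqrt (N * (L + 2)) ^ 2 = N * (L + 2) := Real.sq_sqrt (by positivity)
  set u := Real.sqrt (N * (L + 2))
  rcases lt_or_ge N 64 with hN | hN
  · choose A hA hA' using exists_polynomial_eq_threshold N
    refine ⟨Unit, inferInstance, inferInstance, fun θ _ => A θ, fun θ _ => ?_, fun x => ?_⟩
    · refine (Nat.cast_le.2 (hA θ)).trans ?_
      have : (N : ℝ) < 64 := by exact_mod_cast hN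
      have h0 : (0 : ℝ) ≤ N := Nat.cast_nonneg N
      refine abs_le_of_sq_le_sq' ?_ (by positivity) |>.2
      nlinarith [mul_nonneg h0 hL]
    · simp [hA', Real.exp_nonneg]
  · obtain ⟨n, hn⟩ : ∃ n, n = N / 64 := ⟨_, rfl⟩
    have hn0 : 0 < n := by omega
    have hn1 : 64 * (n : ℝ) ≤ N := by exact_mod_cast (by omega : 64 * n ≤ N)
    have hn2 : (N : ℝ) ≤ 128 * n := by exact_mod_cast (by omega : N ≤ 128 * n)
    have hn' : (0 : ℝ) < n := by exact_mod_cast hn0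
    have hN' : (0 : ℝ) < N := by linarith
    -- One recursive seed serves `θ`, `θ - a` and `θ + a`: the bad event covers all thresholds, so
    -- it is paid for once. Raising `L` by 2 makes room for the sampling error, since `1 + 2 ≤ exp
    -- 2`.
    obtain ⟨Ω, _, _, q, hq, hq'⟩ := ih n (by omega) (L + 2) (by linarith)
    set a : ℝ := Real.sqrt (2 * (L + 2) / n)
    have ha : 0 ≤ a := Real.sqrt_nonneg _
    have ha2 : a ^ 2 = 2 * (L + 2) / n := Real.sq_sqrt (by positivity)
    have ha2' : n * a ^ 2 / 2 = L + 2 := by rw [ha2]; field_simp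
    choose A hA hA' using fun θ => exists_polynomial_eq_threshold_near (n := N) (by omega) θ
      (b := 2 * a) (by positivity)
    have haN : a * N ≤ 16 * u := by
      refine abs_le_of_sq_le_sq' ?_ (by positivity) |>.2
      have h1 : a ^ 2 * N ≤ 256 * (L + 2) := by
        rw [ha2, div_mul_eq_mul_div, div_le_iff₀ hn']
        nlinarith
      calc (a * N) ^ 2 = a ^ 2 * N * N := by ring
        _ ≤ 256 * (L + 2) * N := by gcongr
        _ = (16 * u) ^ 2 := by rw [mul_pow, hu2]; ring
    -- Since `64 * n ≤ N` and `L + 4 ≤ 2 * (L + 2)`, the ratio of the radicands is at most `1/32 <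
    -- 1/25`. The total degree is then at most `64 * u + 3 * 200 * u / 5 = 184 * u`.
    have hrec : Real.sqrt (n * (L + 2 + 2)) ≤ u / 5 := by
      refine Real.sqrt_le_iff.2 ⟨by positivity, ?_⟩
      rw [div_pow, hu2]
      nlinarith [mul_nonneg hn'.le hL, mul_nonneg (sub_nonneg.2 hn1) hL]
    refine ⟨Ω × (Fin n → Fin N), inferInstance, ?_, fun θ ω => rename ω.2 (q θ ω.1) +
      rename ω.2 (q (θ - a) ω.1) * (1 - rename ω.2 (q (θ + a) ω.1)) *
        (A θ - rename ω.2 (q θ ω.1)), fun θ ω => ?_, fun x => ?_⟩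
    · have : Nonempty (Fin N) := ⟨⟨0, by omega⟩⟩
      infer_instance
    · refine (totalDegree_combine_le ω.2 (hA θ) (hq _ _) (hq _ _) (hq _ _)).trans ?_
      linarith
    · have hbound := ncard_prod_or_le (Ω := Ω) (H := Fin n → Fin N)
        (fun ω h => ∃ θ, eval (boolPoint (x ∘ h)) (q θ ω) ≠ bitVal ℤ (thresholdFn n θ (x ∘ h)))
        _ (fun h => hq' (x ∘ h)) (ncard_sample_deviation_le (by omega) x hn0 ha)
      rw [ha2'] at hbound
      have hexp : Real.exp (-(L + 2)) + 2 * Real.exp (-(L + 2)) ≤ Real.exp (-L) := by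
        have h1 : Real.exp (-L) = Real.exp (-(L + 2)) * Real.exp 2 := by
          rw [← Real.exp_add]; ring_nf
        have h2 : (2 : ℝ) + 1 ≤ Real.exp 2 := Real.add_one_le_exp 2
        nlinarith [Real.exp_pos (-(L + 2))]
      refine (Nat.cast_le.2 (Set.ncard_le_ncard ?_ (Set.toFinite _))).trans
        (hbound.trans (mul_le_mul_of_nonneg_right hexp (Nat.cast_nonneg _)))
      rintro ⟨ω, h⟩ ⟨θ, hθ⟩
      by_contra hcon
      simp only [Set.mem_ofPred_eq, not_or, not_exists, not_not, not_lt] at hcon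
      exact hθ (eval_combine h x hcon.2 (hA' θ x) (hcon.1 _) (hcon.1 _) (hcon.1 _))

/-! ### Randomness reduction and passage to arbitrary rings. -/

/-- Reduction of randomness: finitely many events of probability at most `ε` all have frequency at
most `2ε` in some sequence of `T` seeds. -/
theorem exists_seeds_ncard_le {Ω X : Type*} [Fintype Ω] [Nonempty Ω] [Fintype X]
    (bad : X → Ω → Prop) {ε : ℝ} (hε0 : 0 ≤ ε) (hε1 : ε ≤ 1)
    (h : ∀ x, ({ω | bad x ω}.ncard : ℝ) ≤ ε * Fintype.card Ω) (T : ℕ)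
    (hT : Fintype.card X * Real.exp (-(T * ε ^ 2 / 2)) < 1) :
    ∃ g : Fin T → Ω, ∀ x, ({i | bad x (g i)}.ncard : ℝ) ≤ 2 * ε * T := by
  classical
  by_contra! hcon
  have hx : ∀ x, ({g : Fin T → Ω | T * (ε + ε) ≤ ∑ i, if bad x (g i) then (1 : ℝ) else 0}.ncard : ℝ)
      ≤ Real.exp (-(T * ε ^ 2 / 2)) * (Fintype.card Ω : ℝ) ^ T := fun x =>
    card_sum_ge_le_exp (fun ω => if bad x ω then (1 : ℝ) else 0)
      (fun ω => by split_ifs <;> norm_num) (fun ω => by split_ifs <;> norm_num) hε0 hε1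
      (by simpa [Set.ncard_eq_toFinset_card'] using h x) hε0 T
  have huniv : (⋃ x, {g : Fin T → Ω | T * (ε + ε) ≤ ∑ i, if bad x (g i) then (1 : ℝ) else 0})
      = Set.univ := by
    refine Set.eq_univ_of_forall fun g => Set.mem_iUnion.2 ?_
    obtain ⟨x, hx⟩ := hcon g
    refine ⟨x, ?_⟩
    rw [Set.ncard_eq_toFinset_card'] at hx
    simp only [Set.mem_ofPred_eq, Finset.sum_boole]
    rw [Set.toFinset_ofPred] at hx
    linarith
  have hcard : (Fintype.card Ω : ℝ) ^ T ≤
      Fintype.card X * (Real.exp (-(T * ε ^ 2 / 2)) * (Fintype.card Ω : ℝ) ^ T) := by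
    calc (Fintype.card Ω : ℝ) ^ T = ((Set.univ : Set (Fin T → Ω)).ncard : ℝ) := by
          simp [Set.ncard_univ]
      _ ≤ ∑ x, ({g : Fin T → Ω | T * (ε + ε) ≤ ∑ i, if bad x (g i) then (1 : ℝ) else 0}.ncard
            : ℝ) := by
          rw [← huniv]
          exact_mod_cast Set.ncard_iUnion_le_of_fintype _
      _ ≤ _ := by
          refine (Finset.sum_le_sum fun x _ => hx x).trans ?_
          simp
  have hpos : (0 : ℝ) < (Fintype.card Ω : ℝ) ^ T := by
    have : 0 < Fintype.card Ω := Fintype.card_pos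
    positivity
  nlinarith

open MvPolynomial in
/-- A uniform family of integer polynomials that errs rarely gives a probabilistic polynomial over
every commutative ring. -/
theorem isProbabilisticPolynomial_map_uniform {n r : ℕ} {f : (Fin n → Bool) → Bool} {d ε : ℝ}
    (G : (Fin r → Bool) → MvPolynomial (Fin n) ℤ) (hd : ∀ ω, ((G ω).totalDegree : ℝ) ≤ d)
    (hG : ∀ x, ({ω | eval (boolPoint x) (G ω) ≠ bitVal ℤ (f x)}.ncard : ℝ) ≤ ε * 2 ^ r)
    (R : Type*) [CommRing R] :
    IsProbabilisticPolynomial R f d ε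
      (((PMF.uniformOfFintype (Fin r → Bool)).map G).map (map (Int.castRingHom R))) := by
  classical
  constructor
  · intro p hp
    rw [PMF.mem_support_map_iff] at hp
    obtain ⟨q, hq, rfl⟩ := hp
    rw [PMF.mem_support_map_iff] at hq
    obtain ⟨ω, -, rfl⟩ := hq
    refine le_trans (Nat.cast_le.2 ?_) (hd ω)
    exact Finset.sup_mono (support_map_subset _ _)
  · intro x
    have hcast : ∀ b, bitVal R b = Int.castRingHom R (bitVal ℤ b) := by
      intro b; cases b <;> simp [bitVal]
    rw [PMF.toOuterMeasure_map_apply, PMF.toOuterMeasure_map_apply]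
    set good : Set (Fin r → Bool) := {ω | eval (boolPoint x) (G ω) = bitVal ℤ (f x)}
    -- Correct values over ℤ stay correct under `ℤ → R`. Only inclusion is claimed, as a wrong
    -- integer value may become right in `R`.
    have hsub : good ⊆ G ⁻¹' (map (Int.castRingHom R) ⁻¹'
        {p | eval (fun i => bitVal R (x i)) p = bitVal R (f x)}) := by
      intro ω hω
      have hω' : eval (boolPoint x) (G ω) = bitVal ℤ (f x) := hω
      change eval (fun i => bitVal R (x i)) (map (Int.castRingHom R) (G ω)) = bitVal R (f x)
      rw [hcast, ← hω', eval_map]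
      simp only [hcast]
      exact (eval₂_comp_left (Int.castRingHom R) (RingHom.id ℤ) (boolPoint x) (G ω)).symm
    have hmono := MeasureTheory.measure_mono (μ := (PMF.uniformOfFintype (Fin r → Bool)).toOuterMeasure) hsub
    refine le_trans ?_ (ENNReal.toReal_mono ?_ hmono)
    · rw [PMF.toOuterMeasure_uniformOfFintype_apply]
      have hcompl := Set.ncard_add_ncard_compl good
      have hc : goodᶜ = {ω | eval (boolPoint x) (G ω) ≠ bitVal ℤ (f x)} := rfl
      rw [hc] at hcompl
      have hcard : (Nat.card (Fin r → Bool) : ℝ) = 2 ^ r := by simp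
      have hsum : (good.ncard : ℝ) +
          ({ω | eval (boolPoint x) (G ω) ≠ bitVal ℤ (f x)}.ncard : ℝ) = 2 ^ r := by
        rw [← hcard, ← hcompl]; push_cast; rfl
      have hg : (Fintype.card good : ℝ) = good.ncard := by
        rw [Set.ncard_eq_toFinset_card', Set.toFinset_card]
      have h2 : (0 : ℝ) < 2 ^ r := by positivity
      have := hG x
      simp only [ENNReal.toReal_div, ENNReal.toReal_natCast, Fintype.card_fun, Fintype.card_bool,
        Fintype.card_fin, hg]
      push_cast
      rw [le_div_iff₀ h2]
      linarith
    · rw [PMF.toOuterMeasure_uniformOfFintype_apply]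
      exact ENNReal.div_ne_top (ENNReal.natCast_ne_top _) (by simp)

/-- `O(log (ns))` bits suffice to index `8 n s²` seeds. -/
theorem exists_two_pow_ge {n : ℕ} (hn : 2 ≤ n) {s : ℝ} (hs : 2 ≤ s) :
    ∃ r : ℕ, (8 : ℝ) * n * s ^ 2 ≤ 2 ^ r ∧
      (r : ℝ) ≤ 600 * (Real.log n * Real.log (n * s)) := by
  have hn' : (2 : ℝ) ≤ n := by exact_mod_cast hn
  have hlog2 := Real.log_two_gt_d9
  have hln : Real.log 2 ≤ Real.log n := Real.log_le_log (by norm_num) hn'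
  have hls : Real.log 2 ≤ Real.log s := Real.log_le_log (by norm_num) hs
  have hlns : Real.log (n * s) = Real.log n + Real.log s :=
    Real.log_mul (by positivity) (by positivity)
  have hy : Real.log ((8 : ℝ) * n * s ^ 2) = 3 * Real.log 2 + Real.log n + 2 * Real.log s := by
    rw [Real.log_mul (by positivity) (by positivity), Real.log_mul (by positivity) (by positivity),
      show (8 : ℝ) = 2 ^ 3 by norm_num, Real.log_pow, Real.log_pow]
    push_cast
    ring
  refine ⟨⌈Real.logb 2 (8 * n * s ^ 2)⌉₊, ?_, ?_⟩
  · have := (Real.logb_le_iff_le_rpow (by norm_num) (by positivity)).1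
      (Nat.le_ceil (Real.logb 2 (8 * n * s ^ 2)))
    rwa [Real.rpow_natCast] at this
  · have hpos : 0 ≤ Real.logb 2 (8 * n * s ^ 2) :=
      Real.logb_nonneg (by norm_num) (by nlinarith)
    refine (Nat.ceil_lt_add_one hpos).le.trans ?_
    have : Real.logb 2 (8 * n * s ^ 2) ≤ 5 * Real.log (n * s) / Real.log 2 := by
      rw [Real.logb, hy, hlns]
      gcongr
      linarith
    have h2 : 5 * Real.log (n * s) / Real.log 2 ≤ 10 * Real.log (n * s) := by
      rw [div_le_iff₀ (by linarith)]
      nlinarith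
    rw [hlns] at *
    nlinarith

/-! ### Choice of parameters. -/

theorem theorem1 :
    ∃ C : ℝ, 0 < C ∧
      ∀ (θ : ℝ), 0 ≤ θ → θ ≤ 1 → ∀ (n : ℕ), 1 ≤ n → ∀ (s : ℝ), 2 ≤ s →
        ∃ D : PMF (MvPolynomial (Fin n) ℤ),
          (∃ r : ℕ, (r : ℝ) ≤ C * (Real.log n * Real.log (n * s)) ∧ SampledWithBits D r) ∧
          ∀ (R : Type*) [CommRing R],
            IsProbabilisticPolynomial R (thresholdFn n θ) (C * Real.sqrt (n * Real.log s)) (1 / s)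
              (D.map (MvPolynomial.map (Int.castRingHom R))) := by
  refine ⟨600, by norm_num, fun θ _ _ n hn s hs => ?_⟩
  have hlog2 := Real.log_two_gt_d9
  have hls : Real.log 2 ≤ Real.log s := Real.log_le_log (by norm_num) hs
  have hs0 : 0 < s := by linarith
  -- For `n = 1` the bit budget is `log 1 = 0`, so the polynomial must be deterministic.
  rcases hn.eq_or_lt with rfl | hn2
  · obtain ⟨A, hA, hA'⟩ := exists_polynomial_eq_threshold 1 θ
    refine ⟨_, ⟨0, by simp, fun _ => A, rfl⟩, fun R _ =>
      isProbabilisticPolynomial_map_uniform _ (fun _ => ?_) (fun x => ?_) R⟩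
    · have h1 : (1 / 2 : ℝ) ≤ Real.sqrt ((1 : ℕ) * Real.log s) :=
        Real.le_sqrt_of_sq_le (by push_cast; linarith)
      have : (A.totalDegree : ℝ) ≤ 1 := by exact_mod_cast hA
      push_cast at h1 ⊢
      linarith
    · simp [hA', hs0.le]
  · have hn' : (2 : ℝ) ≤ n := by exact_mod_cast hn2
    obtain ⟨r, hr, hr'⟩ := exists_two_pow_ge hn2 hs
    have hL : 0 ≤ Real.log (2 * s) := Real.log_nonneg (by linarith)
    -- `L = log (2 * s)` gives error `ε = 1 / (2 * s)`, which doubles to `1 / s`. With `T = 2 ^ r ≥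
    -- 8 * n * s ^ 2` seeds, `T * ε ^ 2 / 2 ≥ n`, and the union bound reads `2 ^ n * exp (-n) < 1`.
    obtain ⟨Ω, _, _, p, hp, hp'⟩ := exists_random_threshold_polynomial n (Real.log (2 * s)) hL
    rw [Real.exp_neg, Real.exp_log (by linarith)] at hp'
    have hε : (2 * s)⁻¹ ≤ 1 := inv_le_one_of_one_le₀ (by linarith)
    obtain ⟨g, hg⟩ := exists_seeds_ncard_le _ (by positivity) hε hp' (2 ^ r) (by
      have h1 : (n : ℝ) ≤ ((2 ^ r : ℕ) : ℝ) * (2 * s)⁻¹ ^ 2 / 2 := by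
        rw [inv_pow, ← div_eq_mul_inv, div_div, le_div_iff₀ (by positivity)]
        push_cast
        linarith
      have h2 : Real.exp (-(((2 ^ r : ℕ) : ℝ) * (2 * s)⁻¹ ^ 2 / 2)) ≤ Real.exp (-n) :=
        Real.exp_le_exp.2 (neg_le_neg h1)
      have h3 : ((Fintype.card (Fin n → Bool) : ℕ) : ℝ) * Real.exp (-n) < 1 := by
        rw [Real.exp_neg, ← div_eq_mul_inv, div_lt_one (Real.exp_pos _), ← mul_one (n : ℝ),
          Real.exp_nat_mul]
        simp only [Fintype.card_fun, Fintype.card_bool, Fintype.card_fin]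
        push_cast
        exact pow_lt_pow_left₀ (by linarith [Real.exp_one_gt_d9]) (by norm_num) (by omega)
      exact (mul_le_mul_of_nonneg_left h2 (Nat.cast_nonneg _)).trans_lt h3)
    have e : (Fin r → Bool) ≃ Fin (2 ^ r) := Fintype.equivFinOfCardEq (by simp)
    refine ⟨_, ⟨r, hr', fun ω => p θ (g (e ω)), rfl⟩, fun R _ =>
      isProbabilisticPolynomial_map_uniform _ (fun ω => ?_) (fun x => ?_) R⟩
    · refine (hp θ _).trans ?_
      have h1 : Real.sqrt (n * (Real.log (2 * s) + 2)) ≤ 3 * Real.sqrt (n * Real.log s) := by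
        have hl : 0 ≤ Real.log s := by linarith
        refine Real.sqrt_le_iff.2 ⟨by positivity, ?_⟩
        rw [mul_pow, Real.sq_sqrt (by positivity), Real.log_mul (by norm_num) hs0.ne']
        have : Real.log 2 + Real.log s + 2 ≤ 9 * Real.log s := by linarith
        calc _ ≤ (n : ℝ) * (9 * Real.log s) := by gcongr
          _ = _ := by ring
      linarith
    · have h1 := hg x
      rw [show 2 * (2 * s)⁻¹ = 1 / s by field_simp] at h1
      push_cast at h1
      refine le_trans (Nat.cast_le.2 ?_) h1
      rw [← Set.ncard_image_of_injective _ e.injective]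
      refine Set.ncard_le_ncard ?_ (Set.toFinite _)
      rintro _ ⟨ω, hω, rfl⟩
      exact ⟨θ, hω⟩
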